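/- All graphs are finite and simple. A graph is called unicyclic if it is connected and contains exactly one cycle. For a graph $G$, let $N(G)$ denote the number of connected induced subgraphs of $G$, that is, the number of nonempty subsets $S \subseteq V(G)$ such that the subgraph of $G$ induced by $S$ is connected. For $n > 2$, let $Q_n$ be the graph obtained from the star on $n$ vertices (one central vertex adjacent to $n-1$ leaves) by adding one edge between two of its leaves. **Theorem.** If $G$ is a unicyclic graph of order $n > 5$, then $$N(G) \le n + 2^{n-1},$$ with equality if and only if $G$ is isomorphic to $Q_n$. -/

import Mathlib

namespace UnicyclicGraphs

/-- A subgraph `C` of `G` is a cycle of `G` if it consists of the vertices and edges of a closed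
walk of `G` that is a cycle. The starting point and the direction of travel are forgotten, so that
cycles are counted as subgraphs. -/
def IsCycleSubgraph {V : Type*} (G : SimpleGraph V) (C : G.Subgraph) : Prop :=
  ∃ (v : V) (w : G.Walk v v), w.IsCycle ∧ w.toSubgraph = C

/-- A graph is unicyclic if it is connected and contains exactly one cycle. -/
def IsUnicyclic {V : Type*} (G : SimpleGraph V) : Prop :=
  G.Connected ∧ ∃! C : G.Subgraph, IsCycleSubgraph G C

/-- The number of connected induced subgraphs of `G`, i.e. of nonempty vertex sets `S` for which
the subgraph of `G` induced by `S` is connected. -/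
noncomputable def numConnectedInduced {V : Type*} (G : SimpleGraph V) : ℕ :=
  {S : Set V | S.Nonempty ∧ (G.induce S).Connected}.ncard

/-- The graph `Q_n` (for `2 < n`): the star on `0, 1, …, n - 1` with central vertex `0`, to which
the edge joining the two leaves `1` and `2` is added. -/
def starPlusEdge (n : ℕ) : SimpleGraph (Fin n) :=
  SimpleGraph.fromRel fun i j => i.val = 0 ∨ (i.val = 1 ∧ j.val = 2)

end UnicyclicGraphs

/-!
Let `N(G)` be the number of connected vertex sets. A unicyclic graph is connected and has as many
edges as vertices (`IsUnicyclic.ncard_edgeSet`), and the bound is shown by induction for all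
connected graphs with at most as many edges as vertices (`numConnectedInduced_le`).

If `v` is a leaf with neighbour `u`, a connected set either avoids `v`, or is `{v}`, or contains
both `u` and `v`. There are at most `2 ^ (n - 2)` sets of the last kind, so
`N(G) ≤ N(G - v) + 1 + 2 ^ (n - 2)`, which is exactly the increment of `n + 2 ^ (n - 1)`. Equality
forces `{u, v, x}` to be connected for every `x`, that is, `u` is adjacent to all other vertices;
the single edge that remains besides those at `u` makes `G` the graph `Q_n`.

If there is no leaf, `G` is 2-regular, hence a cycle. Its connected sets are the whole vertex set
and the arcs, at most `n (n - 1) + 1` in number, which is below `n + 2 ^ (n - 1)` for `6 ≤ n`. Among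
the small cycles only the one of length 4 violates the bound, by one. This does no harm in the
induction: in the 4-cycle no vertex is adjacent to all others, so that attaching a leaf to it gains
one less than in general.

Conversely, in `Q_n` all `2 ^ (n - 1)` sets that contain the centre are connected, and so are the
`n - 1` other singletons and the pair of adjacent non-central vertices.
-/

namespace UnicyclicGraphs

open SimpleGraph

/-! ### Connected vertex sets -/

/-- A part `A` of a connected vertex set `S` that is not left by any edge inside `S` is all
of `S`. -/
lemma subset_of_connected_induce {V : Type*} {G : SimpleGraph V} {S A : Set V} {x : V}
    (hS : (G.induce S).Connected) (hxS : x ∈ S) (hxA : x ∈ A)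
    (hA : ∀ a ∈ A, ∀ b ∈ S, G.Adj a b → b ∈ A) : S ⊆ A := by
  have key : ∀ (y z : S), (G.induce S).Walk y z → y.1 ∈ A → z.1 ∈ A := by
    intro y z w
    induction w with
    | nil => exact id
    | cons h _ ih => exact fun hy => ih (hA _ hy _ (Subtype.prop _) h)
  intro y hy
  obtain ⟨w⟩ := hS.preconnected ⟨x, hxS⟩ ⟨y, hy⟩
  exact key _ _ w hxA

lemma connected_induce_of_dominating {V : Type*} {G : SimpleGraph V} {S : Set V} {u : V}
    (hu : u ∈ S) (h : ∀ x ∈ S, x ≠ u → G.Adj u x) : (G.induce S).Connected := by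
  rw [connected_iff_exists_forall_reachable]
  refine ⟨⟨u, hu⟩, fun ⟨x, hx⟩ => ?_⟩
  by_cases hxu : x = u
  · subst hxu
    exact Reachable.refl _
  · exact Adj.reachable (h x hx hxu : (G.induce S).Adj ⟨u, hu⟩ ⟨x, hx⟩)

lemma ncard_setOf_superset {V : Type*} [Fintype V] (A : Set V) :
    {S : Set V | A ⊆ S}.ncard = 2 ^ (Fintype.card V - A.ncard) := by
  have h : {S : Set V | A ⊆ S} = compl '' (𝒫 Aᶜ) := by
    ext S
    refine ⟨fun h => ⟨Sᶜ, ?_, compl_compl S⟩, ?_⟩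
    · exact Set.compl_subset_compl.2 h
    · rintro ⟨T, hT, rfl⟩
      exact Set.subset_compl_comm.1 hT
  rw [h, Set.ncard_image_of_injective _ compl_injective, Set.ncard_powerset, Set.ncard_compl,
    Nat.card_eq_fintype_card]

lemma numConnectedInduced_le_two_pow {V : Type*} [Fintype V] (G : SimpleGraph V) :
    numConnectedInduced G ≤ 2 ^ Fintype.card V := by
  refine (Set.ncard_le_ncard (Set.subset_univ _)).trans_eq ?_
  simp [Set.ncard_univ]

/-! ### Deleting a leaf -/

lemma numConnectedInduced_le_of_leaf {V : Type*} [Fintype V] {G : SimpleGraph V} {u v : V}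
    (hv : ∀ w, G.Adj v w ↔ w = u) :
    numConnectedInduced G ≤ numConnectedInduced (G.induce {v}ᶜ) + 1 +
      {S : Set V | {u, v} ⊆ S ∧ (G.induce S).Connected}.ncard := by
  have hsub : {S : Set V | S.Nonempty ∧ (G.induce S).Connected} ⊆
      ((Subtype.val '' ·) '' {S : Set ({v}ᶜ : Set V) |
        S.Nonempty ∧ ((G.induce {v}ᶜ).induce S).Connected} ∪ {{v}}) ∪
      {S : Set V | {u, v} ⊆ S ∧ (G.induce S).Connected} := by
    rintro S ⟨hne, hS⟩
    by_cases hvS : v ∈ S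
    · by_cases huS : u ∈ S
      · exact Or.inr ⟨Set.pair_subset huS hvS, hS⟩
      · refine Or.inl (Or.inr ?_)
        -- without `u`, no edge of `S` leaves `v`
        have := subset_of_connected_induce (A := {v}) hS hvS rfl (by
          rintro a rfl b hb hab
          exact absurd ((hv b).1 hab ▸ hb) huS)
        exact this.antisymm (Set.singleton_subset_iff.2 hvS)
    · refine Or.inl (Or.inl ⟨Subtype.val ⁻¹' S, ⟨?_, ?_⟩, ?_⟩)
      · obtain ⟨x, hx⟩ := hne
        exact ⟨⟨x, fun h => hvS (h ▸ hx)⟩, hx⟩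
      · let e : (G.induce {v}ᶜ).induce (Subtype.val ⁻¹' S) ≃g G.induce S :=
          { toFun := fun x => ⟨x.1.1, x.2⟩
            invFun := fun x => ⟨⟨x.1, fun h => hvS (h ▸ x.2)⟩, x.2⟩
            left_inv := fun _ => rfl
            right_inv := fun _ => rfl
            map_rel_iff' := Iff.rfl }
        exact e.connected_iff.2 hS
      · refine Subtype.image_preimage_coe _ _ |>.trans (Set.inter_eq_right.2 ?_)
        exact fun x hx h => hvS (h ▸ hx)
  refine (Set.ncard_le_ncard hsub).trans ((Set.ncard_union_le _ _).trans ?_)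
  refine Nat.add_le_add_right ((Set.ncard_union_le _ _).trans ?_) _
  rw [Set.ncard_singleton]
  exact Nat.add_le_add_right Set.ncard_image_le _

lemma ncard_connected_pair_le {V : Type*} [Fintype V] (G : SimpleGraph V) {u v : V}
    (huv : u ≠ v) :
    {S : Set V | {u, v} ⊆ S ∧ (G.induce S).Connected}.ncard ≤ 2 ^ (Fintype.card V - 2) := by
  have h := ncard_setOf_superset {u, v}
  rw [Set.ncard_pair huv] at h
  rw [← h]
  exact Set.ncard_le_ncard fun S hS => hS.1

/-- The bound is strict if a vertex `x` is not adjacent to `u`: the set `{u, v, x}` is not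
connected. -/
lemma ncard_connected_pair_lt {V : Type*} [Fintype V] {G : SimpleGraph V} {u v x : V}
    (hv : ∀ w, G.Adj v w ↔ w = u) (hxu : x ≠ u) (hxv : x ≠ v) (hux : ¬ G.Adj u x) :
    {S : Set V | {u, v} ⊆ S ∧ (G.induce S).Connected}.ncard < 2 ^ (Fintype.card V - 2) := by
  have huv : u ≠ v := ((hv u).2 rfl).ne'
  have h := ncard_setOf_superset {u, v}
  rw [Set.ncard_pair huv] at h
  rw [← h]
  refine Set.ncard_lt_ncard ⟨fun S hS => hS.1, fun h => ?_⟩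
  have hS := (h (show ({u, v, x} : Set V) ∈ {S : Set V | {u, v} ⊆ S} by
    intro y; simp only [Set.mem_insert_iff, Set.mem_singleton_iff]; tauto)).2
  have := subset_of_connected_induce (A := {u, v}) (x := u) hS (by simp) (by simp) (by
    rintro a (rfl | rfl) b (rfl | rfl | rfl) hab
    · simp
    · simp
    · exact absurd hab hux
    · simp
    · simp
    · exact absurd ((hv _).1 hab) hxu)
  have hx := this (show x ∈ ({u, v, x} : Set V) by simp)
  simp [hxu, hxv] at hx

/-! ### Cycles -/

/-- In a graph all of whose vertices lie on a cycle without chords, every connected set other than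
the whole vertex set is an arc, given by its first vertex and its length. The map `f` runs around
the cycle with period `n`. -/
lemma numConnectedInduced_le_of_cyclic {V : Type*} [Fintype V] {G : SimpleGraph V} {n : ℕ}
    (hn : 0 < n) {f : ℕ → V} (hper : ∀ i, f (i + n) = f i) (hsurj : ∀ x, ∃ i, f i = x)
    (hadj : ∀ i y, G.Adj (f (i + 1)) y → y = f i ∨ y = f (i + 2)) :
    numConnectedInduced G ≤ n * (n - 1) + 1 := by
  have hmod : ∀ i, f (i % n) = f i := fun i => by
    have h : ∀ k j, f (j + n * k) = f j := by
      intro k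
      induction k with
      | zero => simp
      | succ k ih => intro j; rw [Nat.mul_succ, ← add_assoc, hper, ih]
    conv_rhs => rw [← Nat.mod_add_div i n, h]
  have hsub : {S : Set V | S.Nonempty ∧ (G.induce S).Connected} ⊆
      (fun q : ℕ × ℕ => f '' Set.Ioc q.1 (q.1 + 1 + q.2)) '' (Set.Iio n ×ˢ Set.Iio (n - 1)) ∪
        {Set.univ} := by
    classical
    rintro S ⟨hne, hS⟩
    by_cases hSu : S = Set.univ
    · exact Or.inr hSu
    left
    obtain ⟨y, hy⟩ := (Set.ne_univ_iff_exists_notMem S).1 hSu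
    obtain ⟨j, rfl⟩ := hsurj y
    obtain ⟨x, hx⟩ := hne
    obtain ⟨l, rfl⟩ := hsurj x
    -- the first index after `j` that leads into `S`
    have hex : ∃ t, f (j + t) ∈ S := by
      refine ⟨l + (n * j - j), ?_⟩
      have : j ≤ n * j := Nat.le_mul_of_pos_left _ hn
      rw [show j + (l + (n * j - j)) = l + n * j by omega, ← hmod]
      simpa [hmod] using hx
    have ht := Nat.find_spec hex
    have ht0 : Nat.find hex ≠ 0 := fun h => hy (by simpa [h] using ht)
    obtain ⟨t, hteq⟩ := Nat.exists_eq_succ_of_ne_zero ht0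
    have htm : f (j + t) ∉ S := Nat.find_min hex (by omega)
    rw [hteq] at ht
    -- reduced modulo `n`, this index gives the first vertex `f (a + 1)` of the arc
    obtain ⟨a, ha, hain, haout⟩ : ∃ a < n, f (a + 1) ∈ S ∧ f a ∉ S := by
      refine ⟨(j + t) % n, Nat.mod_lt _ hn, ?_, by rwa [hmod]⟩
      rw [← hmod, Nat.mod_add_mod, hmod]
      exact ht
    have hex2 : ∃ k, f (a + 1 + k) ∉ S := by
      refine ⟨n - 1, ?_⟩
      rw [show a + 1 + (n - 1) = a + n by omega, hper]
      exact haout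
    have hk := Nat.find_spec hex2
    have hkm : ∀ i < Nat.find hex2, f (a + 1 + i) ∈ S := fun i hi =>
      not_not.1 (Nat.find_min hex2 hi)
    have hkn : Nat.find hex2 ≤ n - 1 := Nat.find_min' hex2 (by
      rw [show a + 1 + (n - 1) = a + n by omega, hper]
      exact haout)
    generalize Nat.find hex2 = k at hk hkm hkn
    have hk0 : k ≠ 0 := by
      rintro rfl
      exact hk hain
    refine ⟨(a, k - 1), ⟨ha, show k - 1 < n - 1 by omega⟩, ?_⟩
    apply Set.Subset.antisymm
    · rintro _ ⟨i, ⟨hi1, hi2⟩, rfl⟩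
      have hi1 : a < i := hi1
      have hi2 : i ≤ a + 1 + (k - 1) := hi2
      have := hkm (i - (a + 1)) (by omega)
      rwa [show a + 1 + (i - (a + 1)) = i by omega] at this
    · refine subset_of_connected_induce hS hain
        ⟨a + 1, ⟨by simp, show a + 1 ≤ a + 1 + (k - 1) by omega⟩, rfl⟩ ?_
      rintro _ ⟨i, ⟨hi1, hi2⟩, rfl⟩ b hb hab
      have hi1 : a < i := hi1
      have hi2 : i ≤ a + 1 + (k - 1) := hi2
      obtain ⟨i, rfl⟩ : ∃ i', i = i' + 1 := ⟨i - 1, by omega⟩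
      rcases hadj i b hab with rfl | rfl
      · refine ⟨i, ⟨show a < i from ?_, show i ≤ a + 1 + (k - 1) by omega⟩, rfl⟩
        rcases Nat.lt_or_ge a i with h | h
        · exact h
        · exact absurd hb (by rwa [show i = a by omega])
      · refine ⟨i + 2, ⟨show a < i + 2 by omega, show i + 2 ≤ a + 1 + (k - 1) from ?_⟩, rfl⟩
        by_contra h
        exact hk (by rwa [show a + 1 + k = i + 2 by omega])
  refine (Set.ncard_le_ncard hsub (Set.toFinite _)).trans ((Set.ncard_union_le _ _).trans ?_)
  rw [Set.ncard_singleton]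
  refine Nat.add_le_add_right ((Set.ncard_image_le (Set.toFinite _)).trans_eq ?_) _
  rw [Set.ncard_prod]
  simp [Set.ncard_eq_toFinset_card']

lemma numConnectedInduced_le_of_degree_eq_two {V : Type*} [Fintype V] {G : SimpleGraph V}
    (hconn : G.Connected) (hdeg : ∀ v, (G.neighborSet v).ncard = 2) :
    numConnectedInduced G ≤ Fintype.card V * (Fintype.card V - 1) + 1 := by
  classical
  obtain ⟨v⟩ := hconn.nonempty
  have hcyc : G.IsCycles := fun v _ => hdeg v
  obtain ⟨p, hp, hverts⟩ := hcyc.exists_cycle_toSubgraph_verts_eq_connectedComponentSupp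
    (c := G.connectedComponentMk v) (v := v) rfl
    (Set.nonempty_of_ncard_ne_zero (by rw [hdeg]; decide))
  have hall : ∀ x, x ∈ p.toSubgraph.verts := fun x => by
    rw [hverts]
    exact ConnectedComponent.sound (hconn.preconnected x v)
  have hnbr : ∀ x y, G.Adj x y → y ∈ p.toSubgraph.neighborSet x := fun x y h =>
    (hp.adj_toSubgraph_iff_of_isCycles hcyc (hall x) y).2 h
  have h3 := hp.three_le_length
  have hper : ∀ i, p.getVert (i % p.length) = p.getVert i ∨ p.length < i := by
    intro i
    rcases lt_trichotomy i p.length with h | h | h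
    · left; rw [Nat.mod_eq_of_lt h]
    · left; rw [h]; simp
    · exact Or.inr h
  have hle : p.length ≤ Fintype.card V := by
    have : Function.Injective (fun i : Fin p.length => p.getVert i) := fun i j hij =>
      Fin.ext (hp.getVert_injOn' (show (i : ℕ) ≤ p.length - 1 by omega)
        (show (j : ℕ) ≤ p.length - 1 by omega) hij)
    simpa using Fintype.card_le_of_injective _ this
  refine (numConnectedInduced_le_of_cyclic (n := p.length) (f := fun i => p.getVert (i % p.length))
    (by omega) (fun i => by simp) ?_ ?_).trans ?_
  · intro x
    obtain ⟨i, hi, hil⟩ := (Walk.mem_support_iff_exists_getVert).1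
      ((Walk.mem_verts_toSubgraph p).1 (hall x))
    exact ⟨i, ((hper i).resolve_right (by omega)).trans hi⟩
  · intro i y h
    have hy := hnbr _ _ h
    have hlt : i % p.length < p.length := Nat.mod_lt _ (by omega)
    have e1 : (i + 1) % p.length = (i % p.length + 1) % p.length := by simp
    have e2 : (i + 2) % p.length = (i % p.length + 2) % p.length := by simp
    simp only [e1, e2] at hy ⊢
    generalize i % p.length = r at hy hlt
    rcases Nat.lt_or_ge (r + 1) p.length with h1 | h1
    · rw [Nat.mod_eq_of_lt h1, hp.neighborSet_toSubgraph_internal (by omega) h1] at hy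
      rw [(hper (r + 2)).resolve_right (by omega)]
      simpa using hy
    · -- the index `r + 1` is the base point of the cycle
      obtain hr : r + 1 = p.length := by omega
      have hr2 : (r + 2) % p.length = 1 := by
        rw [show r + 2 = p.length + 1 by omega, Nat.add_mod_left, Nat.mod_eq_of_lt (by omega)]
      rw [hr, Nat.mod_self, Walk.getVert_zero, hp.neighborSet_toSubgraph_endpoint] at hy
      rw [hr2, show r = p.length - 1 by omega]
      exact (by simpa using hy : y = p.snd ∨ y = p.penultimate).symm
  · gcongr

/-! ### Connected graphs with at most as many edges as vertices -/

lemma ncard_edgeSet_induce_compl_singleton {V : Type*} [Fintype V] (G : SimpleGraph V) (v : V) :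
    (G.induce {v}ᶜ).edgeSet.ncard = G.edgeSet.ncard - (G.neighborSet v).ncard := by
  classical
  have h := (G.card_edgeFinset_induce_compl_singleton v).trans
    (G.card_edgeFinset_deleteIncidenceSet v)
  rw [← card_neighborSet_eq_degree, ← Set.toFinset_card, edgeFinset, edgeFinset,
    ← Set.ncard_eq_toFinset_card', ← Set.ncard_eq_toFinset_card',
    ← Set.ncard_eq_toFinset_card'] at h
  exact h

/-- The hypotheses of the induction pass to the graph without the leaf `v`. -/
lemma induce_compl_singleton_of_leaf {V : Type*} [Fintype V] {G : SimpleGraph V} {u v : V}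
    [Fintype ({v}ᶜ : Set V)] {n : ℕ} (hconn : G.Connected) (hv : ∀ w, G.Adj v w ↔ w = u)
    (hV : Fintype.card V = n) (hE : G.edgeSet.ncard ≤ n) :
    (G.induce {v}ᶜ).Connected ∧ Fintype.card ({v}ᶜ : Set V) = n - 1 ∧
      (G.induce {v}ᶜ).edgeSet.ncard ≤ n - 1 := by
  classical
  have hnv : (G.neighborSet v).ncard = 1 := Set.ncard_eq_one.2 ⟨u, Set.ext hv⟩
  refine ⟨hconn.induce_compl_singleton_of_degree_eq_one ?_, ?_, ?_⟩
  · rwa [← card_neighborSet_eq_degree, ← Set.toFinset_card, ← Set.ncard_eq_toFinset_card']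
  · rw [← Nat.card_eq_fintype_card, Nat.card_coe_set_eq, Set.ncard_compl, Set.ncard_singleton,
      Nat.card_eq_fintype_card, hV]
  · rw [ncard_edgeSet_induce_compl_singleton, hnv]
    omega

/-- By the degree sum formula, a connected graph with at most as many edges as vertices and
without leaves is 2-regular. -/
lemma exists_leaf_or_degree_eq_two {V : Type*} [Fintype V] [Nontrivial V] {G : SimpleGraph V}
    (hconn : G.Connected) (hE : G.edgeSet.ncard ≤ Fintype.card V) :
    (∃ u v, ∀ w, G.Adj v w ↔ w = u) ∨ ∀ v, (G.neighborSet v).ncard = 2 := by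
  classical
  by_cases hleaf : ∃ v, G.degree v = 1
  · obtain ⟨v, hv⟩ := hleaf
    obtain ⟨u, hu, huniq⟩ := degree_eq_one_iff_existsUnique_adj.1 hv
    exact Or.inl ⟨u, v, fun w => ⟨huniq w, fun h => h ▸ hu⟩⟩
  · right
    push Not at hleaf
    have h2 : ∀ v ∈ Finset.univ, 2 ≤ G.degree v := fun v _ => by
      have := hconn.preconnected.degree_pos_of_nontrivial v
      have := hleaf v
      omega
    have hsum := G.sum_degrees_eq_twice_card_edges
    have hle := Finset.sum_le_sum h2
    rw [Set.ncard_eq_toFinset_card'] at hE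
    change G.edgeFinset.card ≤ _ at hE
    have heq : ∑ _v : V, 2 = ∑ v, G.degree v := by
      refine le_antisymm hle ?_
      rw [hsum, Finset.sum_const, Finset.card_univ, smul_eq_mul]
      omega
    intro v
    rw [Set.ncard_eq_toFinset_card', Set.toFinset_card, card_neighborSet_eq_degree]
    exact ((Finset.sum_eq_sum_iff_of_le h2).1 heq v (Finset.mem_univ v)).symm

lemma mul_pred_add_one_lt {n : ℕ} (hn : 6 ≤ n) : n * (n - 1) + 1 < n + 2 ^ (n - 1) := by
  obtain ⟨k, rfl⟩ := Nat.exists_eq_add_of_le' hn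
  induction k with
  | zero => decide
  | succ k ih =>
    have ih := ih (by omega)
    simp only [show k + 1 + 6 - 1 = (k + 5) + 1 by omega, show k + 6 - 1 = k + 5 by omega,
      pow_succ] at ih ⊢
    nlinarith

/-- The inequality of the theorem, for connected graphs with at most as many edges as vertices. It
fails for the 4-cycle only, where it is off by one. -/
lemma numConnectedInduced_le {n : ℕ} {V : Type*} [Fintype V] {G : SimpleGraph V}
    (hV : Fintype.card V = n) (hconn : G.Connected) (hE : G.edgeSet.ncard ≤ n) :
    numConnectedInduced G ≤ n + 2 ^ (n - 1) ∨
      (n = 4 ∧ numConnectedInduced G ≤ 13 ∧ ∀ v, (G.neighborSet v).ncard = 2) := by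
  induction n generalizing V with
  | zero =>
    have := hconn.nonempty
    exact absurd hV Fintype.card_ne_zero
  | succ n ih =>
    rcases Nat.eq_zero_or_pos n with rfl | hn
    · left
      simpa [hV] using numConnectedInduced_le_two_pow G
    have : Nontrivial V := Fintype.one_lt_card_iff_nontrivial.1 (by omega)
    rcases exists_leaf_or_degree_eq_two hconn (hE.trans hV.ge) with ⟨u, v, hv⟩ | h2
    · left
      have : Fintype ({v}ᶜ : Set V) := Fintype.ofFinite _
      obtain ⟨hconn', hV', hE'⟩ := induce_compl_singleton_of_leaf hconn hv hV hE
      rw [Nat.add_sub_cancel] at hV' hE'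
      have hstep := numConnectedInduced_le_of_leaf hv
      obtain ⟨m, rfl⟩ : ∃ m, n = m + 1 := ⟨n - 1, by omega⟩
      rcases ih hV' hconn' hE' with h | ⟨hm, h13, h2⟩
      · have := ncard_connected_pair_le G ((hv u).2 rfl).ne'
        rw [hV] at this
        simp only [Nat.add_sub_cancel, show m + 1 + 1 - 2 = m by omega, pow_succ] at *
        omega
      · -- in the 4-cycle `G - v`, the vertex `u` has a non-neighbour
        have hlt : ∃ x, x ≠ u ∧ x ≠ v ∧ ¬ G.Adj u x := by
          by_contra! hx
          have huv : u ∈ ({v}ᶜ : Set V) := ((hv u).2 rfl).ne'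
          have hc : ((G.induce {v}ᶜ).neighborSet ⟨u, huv⟩)ᶜ ⊆ {⟨u, huv⟩} := by
            rintro ⟨x, hxv⟩ hxn
            by_contra hne
            exact hxn (hx x (fun h => hne (Subtype.ext h)) hxv)
          have := Set.ncard_le_ncard hc
          rw [Set.ncard_compl, h2, Set.ncard_singleton, Nat.card_eq_fintype_card] at this
          omega
        obtain ⟨x, hxu, hxv, hux⟩ := hlt
        have := ncard_connected_pair_lt hv hxu hxv hux
        rw [hV, hm] at this
        rw [hm]
        norm_num at *
        omega
    · have h := numConnectedInduced_le_of_degree_eq_two hconn h2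
      rw [hV] at h
      by_cases h6 : 6 ≤ n + 1
      · exact Or.inl (h.trans (mul_pred_add_one_lt h6).le)
      · by_cases h4 : n + 1 = 4
        · exact Or.inr ⟨h4, by rwa [h4] at h, h2⟩
        · left
          have : n = 1 ∨ n = 2 ∨ n = 4 := by omega
          rcases this with rfl | rfl | rfl <;> exact h.trans (by decide)

/-- In the case of equality some vertex is adjacent to all others. -/
lemma exists_dominating_of_numConnectedInduced_eq {n : ℕ} (hn : 5 < n) {V : Type*} [Fintype V]
    {G : SimpleGraph V} (hV : Fintype.card V = n) (hconn : G.Connected)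
    (hE : G.edgeSet.ncard ≤ n) (h : numConnectedInduced G = n + 2 ^ (n - 1)) :
    ∃ u, ∀ x, x ≠ u → G.Adj u x := by
  have : Nontrivial V := Fintype.one_lt_card_iff_nontrivial.1 (by omega)
  rcases exists_leaf_or_degree_eq_two hconn (hE.trans hV.ge) with ⟨u, v, hv⟩ | h2
  · refine ⟨u, ?_⟩
    by_contra! hx
    obtain ⟨x, hxu, hux⟩ := hx
    have hxv : x ≠ v := fun h => hux (h ▸ ((hv u).2 rfl).symm)
    have hlt := ncard_connected_pair_lt hv hxu hxv hux
    have : Fintype ({v}ᶜ : Set V) := Fintype.ofFinite _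
    obtain ⟨hconn', hV', hE'⟩ := induce_compl_singleton_of_leaf hconn hv hV hE
    have hstep := numConnectedInduced_le_of_leaf hv
    have hH := (numConnectedInduced_le hV' hconn' hE').resolve_right (by omega)
    obtain ⟨m, rfl⟩ : ∃ m, n = m + 2 := ⟨n - 2, by omega⟩
    rw [hV] at hlt
    simp only [Nat.add_sub_cancel, show m + 2 - 1 = m + 1 by omega, pow_succ] at *
    omega
  · have := numConnectedInduced_le_of_degree_eq_two hconn h2
    rw [hV, h] at this
    exact absurd (mul_pred_add_one_lt hn) (by omega)

/-! ### The extremal graph -/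

lemma le_numConnectedInduced_of_dominating {V : Type*} [Fintype V] {G : SimpleGraph V}
    {u a b : V} (hu : ∀ x, x ≠ u → G.Adj u x) (hau : a ≠ u) (hbu : b ≠ u) (hab : G.Adj a b) :
    Fintype.card V + 2 ^ (Fintype.card V - 1) ≤ numConnectedInduced G := by
  have hpos : 0 < Fintype.card V := Fintype.card_pos_iff.2 ⟨u⟩
  have hsub : {S : Set V | {u} ⊆ S} ∪ ((fun x => ({x} : Set V)) '' {u}ᶜ ∪ {{a, b}}) ⊆
      {S : Set V | S.Nonempty ∧ (G.induce S).Connected} := by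
    rintro S (hS | ⟨x, _, rfl⟩ | rfl)
    · have huS : u ∈ S := hS rfl
      exact ⟨⟨u, huS⟩, connected_induce_of_dominating huS fun x _ => hu x⟩
    · exact ⟨⟨x, rfl⟩, connected_induce_of_dominating (u := x) rfl
        fun y hy hyx => absurd hy hyx⟩
    · refine ⟨⟨a, by simp⟩, connected_induce_of_dominating (u := a) (by simp) ?_⟩
      rintro x (rfl | rfl) hx
      · exact absurd rfl hx
      · exact hab
  have h1 : Disjoint ((fun x => ({x} : Set V)) '' {u}ᶜ) {{a, b}} := by
    rw [Set.disjoint_singleton_right]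
    rintro ⟨x, _, hx⟩
    have ha : a ∈ ({x} : Set V) := hx.symm.subset (by simp)
    have hb : b ∈ ({x} : Set V) := hx.symm.subset (by simp)
    exact hab.ne (ha.trans hb.symm)
  have h2 : Disjoint {S : Set V | {u} ⊆ S} ((fun x => ({x} : Set V)) '' {u}ᶜ ∪ {{a, b}}) := by
    rw [Set.disjoint_left]
    rintro S hS (⟨x, hx, rfl⟩ | rfl)
    · exact hx (hS rfl).symm
    · rcases hS rfl with h | h
      · exact hau h.symm
      · exact hbu h.symm
  have h := Set.ncard_le_ncard hsub
  rw [Set.ncard_union_eq h2, Set.ncard_union_eq h1, ncard_setOf_superset,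
    Set.ncard_image_of_injective _ Set.singleton_injective, Set.ncard_compl, Set.ncard_singleton,
    Set.ncard_singleton, Nat.card_eq_fintype_card] at h
  exact le_trans (by omega) h

lemma exists_equiv_fin {V : Type*} [Fintype V] {n : ℕ} (hV : Fintype.card V = n) (hn : 2 < n)
    {u a b : V} (hau : a ≠ u) (hbu : b ≠ u) (hab : a ≠ b) :
    ∃ e : V ≃ Fin n, (e u).val = 0 ∧ (e a).val = 1 ∧ (e b).val = 2 := by
  classical
  let e₀ := Fintype.equivFinOfCardEq hV
  let e₁ := e₀.trans (Equiv.swap (e₀ u) ⟨0, by omega⟩)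
  have h₁ : e₁ u = ⟨0, by omega⟩ := by simp [e₁]
  let e₂ := e₁.trans (Equiv.swap (e₁ a) ⟨1, by omega⟩)
  have h₂u : e₂ u = ⟨0, by omega⟩ := by
    simp only [e₂, Equiv.trans_apply, h₁]
    refine Equiv.swap_apply_of_ne_of_ne (fun h => hau (e₁.injective (h.symm.trans h₁.symm))) ?_
    simp
  have h₂a : e₂ a = ⟨1, by omega⟩ := by simp [e₂]
  let e₃ := e₂.trans (Equiv.swap (e₂ b) ⟨2, by omega⟩)
  refine ⟨e₃, ?_, ?_, ?_⟩
  · have : e₃ u = ⟨0, by omega⟩ := by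
      simp only [e₃, Equiv.trans_apply, h₂u]
      refine Equiv.swap_apply_of_ne_of_ne
        (fun h => hbu (e₂.injective (h.symm.trans h₂u.symm))) ?_
      simp
    rw [this]
  · have : e₃ a = ⟨1, by omega⟩ := by
      simp only [e₃, Equiv.trans_apply, h₂a]
      refine Equiv.swap_apply_of_ne_of_ne
        (fun h => hab (e₂.injective (h.symm.trans h₂a.symm)).symm) ?_
      simp
    rw [this]
  · simp [e₃]

lemma nonempty_iso_starPlusEdge_of_dominating {V : Type*} [Fintype V] {n : ℕ} (hn : 2 < n)
    {G : SimpleGraph V} (hV : Fintype.card V = n) (hE : G.edgeSet.ncard = n) {u : V}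
    (hu : ∀ x, x ≠ u → G.Adj u x) : Nonempty (G ≃g starPlusEdge n) := by
  have hN : G.neighborSet u = {u}ᶜ := by
    ext x
    exact ⟨fun h => h.ne', hu x⟩
  -- a single edge remains when `u` is deleted
  have h1 := ncard_edgeSet_induce_compl_singleton G u
  rw [hN, Set.ncard_compl, Set.ncard_singleton, Nat.card_eq_fintype_card, hV, hE,
    show n - (n - 1) = 1 by omega, Set.ncard_eq_one] at h1
  obtain ⟨⟨⟨a, hau⟩, ⟨b, hbu⟩⟩, he⟩ := h1
  have hadj : ∀ x y, x ≠ u → y ≠ u →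
      (G.Adj x y ↔ (x = a ∧ y = b) ∨ (x = b ∧ y = a)) := by
    intro x y hx hy
    have := Set.ext_iff.1 he s(⟨x, hx⟩, ⟨y, hy⟩)
    simpa [Sym2.eq_iff, Subtype.ext_iff] using this
  have hab : G.Adj a b := (hadj a b hau hbu).2 (Or.inl ⟨rfl, rfl⟩)
  obtain ⟨e, h0, h1, h2⟩ := exists_equiv_fin hV hn hau hbu hab.ne
  have e0 : ∀ x, (e x).val = 0 ↔ x = u := fun x => by
    rw [← h0, ← Fin.ext_iff, e.apply_eq_iff_eq]
  have e1 : ∀ x, (e x).val = 1 ↔ x = a := fun x => by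
    rw [← h1, ← Fin.ext_iff, e.apply_eq_iff_eq]
  have e2 : ∀ x, (e x).val = 2 ↔ x = b := fun x => by
    rw [← h2, ← Fin.ext_iff, e.apply_eq_iff_eq]
  refine ⟨⟨e, fun {x y} => ?_⟩⟩
  simp only [starPlusEdge, fromRel_adj, e0, e1, e2, ne_eq, e.apply_eq_iff_eq]
  by_cases hx : x = u
  · subst hx
    refine ⟨fun h => hu y (Ne.symm h.1), fun h => ⟨h.ne, Or.inl (Or.inl rfl)⟩⟩
  · by_cases hy : y = u
    · subst hy
      exact ⟨fun h => (hu x hx).symm, fun h => ⟨h.ne, Or.inr (Or.inl rfl)⟩⟩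
    · rw [hadj x y hx hy]
      have := hab.ne
      grind

/-- Deleting an edge of the cycle of a unicyclic graph leaves a tree. -/
lemma IsUnicyclic.ncard_edgeSet {V : Type*} [Fintype V] {G : SimpleGraph V}
    (hG : IsUnicyclic G) : G.edgeSet.ncard = Fintype.card V := by
  classical
  obtain ⟨hconn, _, ⟨v, w, hw, rfl⟩, huniq⟩ := hG
  obtain ⟨e, he⟩ : ∃ e, e ∈ w.edges :=
    List.exists_mem_of_length_pos (by rw [Walk.length_edges]; have := hw.three_le_length; omega)
  have heG := w.edges_subset_edgeSet he
  have hconn' : (G.deleteEdges {e}).Connected := by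
    induction e with
    | h x y =>
      exact hconn.connected_delete_edge_of_not_isBridge
        fun hb => hb.notMem_edges_of_isCycle hw he
  have hacyc : (G.deleteEdges {e}).IsAcyclic := by
    intro x p hp
    -- a cycle of `G - e` is a cycle of `G`, hence equal to the given one and passes through `e`
    have hp' := hp.mapLe (G.deleteEdges_le {e})
    have hsub := huniq _ ⟨x, _, hp', rfl⟩
    have hmem : e ∈ (p.mapLe (G.deleteEdges_le {e})).edges := by
      rw [← Walk.mem_edges_toSubgraph, hsub, Walk.mem_edges_toSubgraph]
      exact he
    rw [Walk.edges_mapLe_eq_edges] at hmem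
    have := p.edges_subset_edgeSet hmem
    simp at this
  have hT := (IsTree.mk hconn' hacyc).card_edgeFinset
  rw [edgeFinset, ← Set.ncard_eq_toFinset_card', edgeSet_deleteEdges,
    Set.ncard_sdiff_singleton_add_one heG] at hT
  exact hT

end UnicyclicGraphs

theorem mainTheorem1 {V : Type*} [Fintype V] (n : ℕ) (hn : 5 < n) (G : SimpleGraph V)
    (hV : Fintype.card V = n) (hG : UnicyclicGraphs.IsUnicyclic G) :
    UnicyclicGraphs.numConnectedInduced G ≤ n + 2 ^ (n - 1) ∧
      (UnicyclicGraphs.numConnectedInduced G = n + 2 ^ (n - 1) ↔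
        Nonempty (G ≃g UnicyclicGraphs.starPlusEdge n)) := by
  have hE : G.edgeSet.ncard = n := hG.ncard_edgeSet.trans hV
  have hle := (UnicyclicGraphs.numConnectedInduced_le hV hG.1 hE.le).resolve_right (by omega)
  refine ⟨hle, fun h => ?_, ?_⟩
  · obtain ⟨u, hu⟩ :=
      UnicyclicGraphs.exists_dominating_of_numConnectedInduced_eq hn hV hG.1 hE.le h
    exact UnicyclicGraphs.nonempty_iso_starPlusEdge_of_dominating (by omega) hV hE hu
  · rintro ⟨φ⟩
    refine hle.antisymm ?_
    let i : ∀ k, k < n → V := fun k hk => φ.symm ⟨k, hk⟩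
    have hi : ∀ k l hk hl, G.Adj (i k hk) (i l hl) ↔
        (UnicyclicGraphs.starPlusEdge n).Adj ⟨k, hk⟩ ⟨l, hl⟩ := fun k l hk hl =>
      φ.symm.map_adj_iff
    have hne : ∀ k l hk hl, k ≠ l → i k hk ≠ i l hl := fun k l hk hl h h' =>
      h (congrArg Fin.val (φ.symm.injective h'))
    have h := UnicyclicGraphs.le_numConnectedInduced_of_dominating (G := G)
      (u := i 0 (by omega)) (a := i 1 (by omega)) (b := i 2 (by omega)) ?_
      (hne _ _ _ _ (by decide)) (hne _ _ _ _ (by decide)) ?_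
    · rwa [hV] at h
    · intro x hx
      have hx' : x = i (φ x).val (φ x).isLt := (φ.symm_apply_apply x).symm
      rw [hx', hi]
      simp only [UnicyclicGraphs.starPlusEdge, SimpleGraph.fromRel_adj]
      refine ⟨fun h => hx (hx'.trans ?_), Or.inl (Or.inl trivial)⟩
      exact congrArg φ.symm h.symm
    · rw [hi]
      simp [UnicyclicGraphs.starPlusEdge]
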